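/- Let $m,n$ be natural numbers with $m=2$ or $n=2$, and let $n_0=\min\{m,n\}$. For $B\in\mathbb{M}_{m\times n}(\mathbb{C})$ let $\boldsymbol\sigma(B)=(\sigma_1(B),\ldots,\sigma_{n_0}(B))$ be the vector of singular values of $B$ in non-increasing order, counted with multiplicity, and for $1<p<\infty$ let $\|B\|_p=\big(\sum_{i=1}^{n_0}\sigma_i(B)^p\big)^{1/p}$ be the Schatten $p$-norm ($c_p$-norm). Let $\mathcal{M}$ be a linear subspace of $\mathbb{M}_{m\times n}(\mathbb{C})$ (a real-linear subspace suffices; in particular $\mathcal M$ may be any complex subspace) and let $A\in\mathbb{M}_{m\times n}(\mathbb{C})$. Then: 1. for every real $p$ with $1<p<\infty$ there is a unique $Y_p\in\mathcal{M}$, the $c_p$-approximation of $A$, such that $\|A-Y_p\|_p=\min_{X\in\mathcal{M}}\|A-X\|_p$; 2. there is a unique $Y^{(st)}\in\mathcal{M}$, the strict spectral approximation of $A$, such that $\boldsymbol\sigma(A-Y^{(st)})$ is minimal with respect to the lexicographic ordering on the set $\{\boldsymbol\sigma(A-X):X\in\mathcal{M}\}$; 3. $Y_p\to Y^{(st)}$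 as $p\to\infty$. -/

import Mathlib

open Filter Topology

namespace SpectralApprox

/-- The vector `σ(A) = (σ₁(A), …, σ_{n₀}(A))`, `n₀ = min m n`, of singular values of a complex
`m × n` matrix in non-increasing order, counted with multiplicity. Indices start at `0`, so the
largest singular value is the entry with index `0`. -/
noncomputable def sigma {m n : ℕ} (A : Matrix (Fin m) (Fin n) ℂ) : Fin (min m n) → ℝ :=
  fun i => (Matrix.toEuclideanLin A).singularValues (i : ℕ)

/-- The Schatten `p`-norm (`c_p`-norm) `(∑ᵢ σᵢ(A)ᵖ)^(1/p)`. -/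
noncomputable def cpNorm {m n : ℕ} (p : ℝ) (A : Matrix (Fin m) (Fin n) ℂ) : ℝ :=
  (∑ i, sigma A i ^ p) ^ (1 / p)

/-- `Y` is a best approximation of `A` in the set `M` with respect to the `c_p`-norm. -/
def IsCpApprox {m n : ℕ} (M : Set (Matrix (Fin m) (Fin n) ℂ)) (A : Matrix (Fin m) (Fin n) ℂ)
    (p : ℝ) (Y : Matrix (Fin m) (Fin n) ℂ) : Prop :=
  Y ∈ M ∧ ∀ X ∈ M, cpNorm p (A - Y) ≤ cpNorm p (A - X)

/-- `Y` is a strict spectral approximation of `A` in the set `M`: the vector `σ(A - Y)` is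
lexicographically minimal among the vectors `σ(A - X)`, `X ∈ M`. -/
def IsStrictSpectralApprox {m n : ℕ} (M : Set (Matrix (Fin m) (Fin n) ℂ))
    (A : Matrix (Fin m) (Fin n) ℂ) (Y : Matrix (Fin m) (Fin n) ℂ) : Prop :=
  Y ∈ M ∧ ∀ X ∈ M, toLex (sigma (A - Y)) ≤ toLex (sigma (A - X))

end SpectralApprox

/-!
The Ky Fan norms `σ₁ + ⋯ + σₖ` are seminorms, so `σ(aB + bC)` is weakly majorized by
`aσ(B) + bσ(C)`. Weak majorization forces equality of the vectors as soon as either the sum of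
`p`-th powers fails to drop (strict convexity of `t ^ p`) or the lexicographic order does. Hence two
minimizers have equal singular values, as has their midpoint, and they coincide because the
Frobenius norm `(∑ σᵢ²)^(1/2)` is strictly convex. For the limit, `σ₁ ≤ ‖·‖_p ≤ n₀^(1/p) σ₁` gives
`σ₁(A - Y_p) → σ₁(A - Y^(st))`. If `n₀ ≤ 2`, then `‖A - Y_p‖_p ≤ ‖A - Y^(st)‖_p` together with
`σ₁(A - Y^(st)) ≤ σ₁(A - Y_p)` yields `σ₂(A - Y_p) ≤ σ₂(A - Y^(st))`, so every cluster point of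
`Y_p` is again lexicographically minimal.
-/

namespace SpectralApprox

theorem mul_sum_range_le_sum_range_mul {R : Type*} [Semiring R] [PartialOrder R]
    [IsOrderedRing R] {w d : ℕ → R} {n : ℕ} (hw : Antitone w)
    (hd : ∀ k ≤ n, 0 ≤ ∑ i ∈ Finset.range k, d i) :
    w n * ∑ i ∈ Finset.range n, d i ≤ ∑ i ∈ Finset.range n, w i * d i := by
  induction n with
  | zero => simp
  | succ n ih =>
    calc w (n + 1) * ∑ i ∈ Finset.range (n + 1), d i
        ≤ w n * ∑ i ∈ Finset.range (n + 1), d i :=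
          mul_le_mul_of_nonneg_right (hw n.le_succ) (hd _ le_rfl)
      _ = w n * ∑ i ∈ Finset.range n, d i + w n * d n := by rw [Finset.sum_range_succ, mul_add]
      _ ≤ ∑ i ∈ Finset.range (n + 1), w i * d i := by
          rw [Finset.sum_range_succ]
          gcongr
          exact ih fun k hk => hd k (hk.trans n.le_succ)

theorem sum_mul_le_sum_range {R : Type*} [CommRing R] [LinearOrder R] [IsStrictOrderedRing R]
    {a : ℕ → R} (ha : Antitone a) (ha₀ : ∀ i, 0 ≤ a i) {r k : ℕ} {w : Fin r → R}
    (hw₀ : ∀ i, 0 ≤ w i) (hw₁ : ∀ i, w i ≤ 1) (hw : ∑ i, w i ≤ k) :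
    ∑ i : Fin r, a i * w i ≤ ∑ i ∈ Finset.range k, a i := by
  have excess_sum_le : ∑ i : Fin r, (if (i : ℕ) < k then a i - a k else 0) ≤
      ∑ i ∈ Finset.range k, (a i - a k) := by
    rw [Fin.sum_univ_eq_sum_range (fun i => if i < k then a i - a k else 0), ← Finset.sum_filter]
    refine Finset.sum_le_sum_of_subset_of_nonneg (fun i hi => ?_) fun i hi _ => ?_
    · exact Finset.mem_range.mpr (Finset.mem_filter.mp hi).2
    · exact sub_nonneg.mpr (ha (Finset.mem_range.mp hi).le)
  calc ∑ i : Fin r, a i * w i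
      ≤ ∑ i : Fin r, (a k * w i + if (i : ℕ) < k then a i - a k else 0) := by
        refine Finset.sum_le_sum fun i _ => ?_
        split_ifs with hi
        · nlinarith [ha hi.le, hw₁ i]
        · simpa using mul_le_mul_of_nonneg_right (ha (not_lt.mp hi)) (hw₀ i)
    _ ≤ a k * k + ∑ i ∈ Finset.range k, (a i - a k) := by
        rw [Finset.sum_add_distrib, ← Finset.mul_sum]
        exact add_le_add (mul_le_mul_of_nonneg_left hw (ha₀ k)) excess_sum_le
    _ = ∑ i ∈ Finset.range k, a i := by
        rw [Finset.sum_sub_distrib, Finset.sum_const, Finset.card_range, nsmul_eq_mul]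
        ring

theorem eq_of_toLex_le_of_sum_range_le {α : Type*} [AddCommMonoid α] [LinearOrder α]
    [IsOrderedCancelAddMonoid α] {a c : ℕ → α} {n : ℕ}
    (hsum : ∀ k ≤ n, ∑ i ∈ Finset.range k, c i ≤ ∑ i ∈ Finset.range k, a i)
    (hlex : toLex (fun i : Fin n => a i) ≤ toLex (fun i : Fin n => c i)) :
    (fun i : Fin n => a i) = fun i : Fin n => c i := by
  refine toLex_inj.mp (hlex.eq_of_not_lt ?_)
  rintro ⟨i, heq, hlt⟩
  have hprefix : ∑ j ∈ Finset.range i, a j = ∑ j ∈ Finset.range i, c j :=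
    Finset.sum_congr rfl fun j hj =>
      heq ⟨j, (Finset.mem_range.mp hj).trans i.2⟩ (Finset.mem_range.mp hj)
  have hnext := hsum (i + 1) i.2
  rw [Finset.sum_range_succ, Finset.sum_range_succ, hprefix] at hnext
  exact hnext.not_gt (add_lt_add_right hlt _)

theorem exists_forall_toLex_le_of_isCompact {X α : Type*} [TopologicalSpace X] [LinearOrder α]
    [TopologicalSpace α] [ClosedIicTopology α] {n : ℕ} {f : X → Fin n → α}
    (hf : ∀ i, Continuous fun x => f x i) {S : Set X} (hS : IsCompact S) (hne : S.Nonempty) :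
    ∃ x ∈ S, ∀ y ∈ S, toLex (f x) ≤ toLex (f y) := by
  induction n generalizing S with
  | zero => exact hne.imp fun x hx => ⟨hx, fun y _ => (congrArg _ (Subsingleton.elim _ _)).le⟩
  | succ n ih =>
    obtain ⟨x₀, hx₀, hmin⟩ := hS.exists_isMinOn hne (hf 0).continuousOn
    obtain ⟨x, ⟨hxS, hx₀_eq⟩, hx⟩ := ih (f := fun x => Fin.tail (f x)) (fun i => hf i.succ)
      (hS.inter_right ((isClosed_Iic (a := f x₀ 0)).preimage (hf 0))) ⟨x₀, hx₀, le_rfl⟩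
    refine ⟨x, hxS, fun y hy => le_of_not_gt fun hlt => ?_⟩
    have hxy : f x 0 ≤ f y 0 := hx₀_eq.trans (hmin hy)
    have hyx : f y 0 ≤ f x 0 := Pi.apply_le_of_toLex hlt.le (by simp)
    refine (hx y ⟨hy, hyx.trans hx₀_eq⟩).not_gt ?_
    obtain ⟨i, heq, hi⟩ := hlt
    induction i using Fin.cases with
    | zero => exact absurd hi hxy.not_gt
    | succ i => exact ⟨i, fun j hj => heq j.succ (Fin.succ_lt_succ_iff.mpr hj), hi⟩

theorem rpow_add_mul_sub_lt_rpow {p x y : ℝ} (hp : 1 < p) (hx : 0 ≤ x) (hy : 0 ≤ y)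
    (hxy : x ≠ y) : x ^ p + p * x ^ (p - 1) * (y - x) < y ^ p := by
  rcases hx.eq_or_lt with rfl | hx
  · rw [Real.zero_rpow (by linarith), Real.zero_rpow (by linarith)]
    simpa using Real.rpow_pos_of_pos (hy.lt_of_ne hxy) p
  · have bernoulli : 1 + p * (y / x - 1) < (y / x) ^ p := by
      have h := one_add_mul_self_lt_rpow_one_add (s := y / x - 1)
        (by linarith [div_nonneg hy hx.le])
        (fun h => hxy ((div_eq_one_iff_eq hx.ne').mp (sub_eq_zero.mp h)).symm) hp
      rwa [add_sub_cancel] at h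
    calc x ^ p + p * x ^ (p - 1) * (y - x) = (1 + p * (y / x - 1)) * x ^ p := by
          rw [Real.rpow_sub_one hx.ne']
          field_simp
      _ < (y / x) ^ p * x ^ p := by gcongr
      _ = y ^ p := by rw [← Real.mul_rpow (by positivity) hx.le, div_mul_cancel₀ _ hx.ne']

theorem eq_of_sum_rpow_le_of_sum_range_le {p : ℝ} (hp : 1 < p) {a c : ℕ → ℝ} {n : ℕ}
    (ha₀ : ∀ i, 0 ≤ a i) (hc₀ : ∀ i, 0 ≤ c i) (hc : Antitone c)
    (hsum : ∀ k ≤ n, ∑ i ∈ Finset.range k, c i ≤ ∑ i ∈ Finset.range k, a i)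
    (hpow : ∑ i ∈ Finset.range n, a i ^ p ≤ ∑ i ∈ Finset.range n, c i ^ p) :
    ∀ i < n, c i = a i := by
  -- The tangent line of `t ^ p` at `c i` bounds `a i ^ p` from below, and since the slopes decrease
  -- in `i`, summation by parts turns the prefix inequalities into a nonnegative first-order term.
  have slope_antitone : Antitone fun i => p * c i ^ (p - 1) := fun i j hij =>
    mul_le_mul_of_nonneg_left (Real.rpow_le_rpow (hc₀ j) (hc hij) (by linarith)) (by linarith)
  have hdiff : ∀ k ≤ n, 0 ≤ ∑ i ∈ Finset.range k, (a i - c i) := fun k hk => by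
    rw [Finset.sum_sub_distrib]
    exact sub_nonneg.mpr (hsum k hk)
  have first_order_nonneg : 0 ≤ ∑ i ∈ Finset.range n, p * c i ^ (p - 1) * (a i - c i) :=
    (mul_nonneg (mul_nonneg (by linarith) (Real.rpow_nonneg (hc₀ n) _)) (hdiff n le_rfl)).trans
      (mul_sum_range_le_sum_range_mul slope_antitone hdiff)
  by_contra! ⟨i, hi, hne⟩
  have tangent_lt : ∑ i ∈ Finset.range n, (c i ^ p + p * c i ^ (p - 1) * (a i - c i)) <
      ∑ i ∈ Finset.range n, a i ^ p := by
    refine Finset.sum_lt_sum (fun j _ => ?_)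
      ⟨i, Finset.mem_range.mpr hi, rpow_add_mul_sub_lt_rpow hp (hc₀ i) (ha₀ i) hne⟩
    rcases eq_or_ne (c j) (a j) with h | h
    · simp [h]
    · exact (rpow_add_mul_sub_lt_rpow hp (hc₀ j) (ha₀ j) h).le
  rw [Finset.sum_add_distrib] at tangent_lt
  linarith

section LinearMap

open Module LinearMap
open scoped InnerProductSpace

variable {𝕜 E F : Type*} [RCLike 𝕜]
  [NormedAddCommGroup E] [InnerProductSpace 𝕜 E] [NormedAddCommGroup F] [InnerProductSpace 𝕜 F]

theorem norm_sq_sum_smul_of_orthonormal {ι : Type*} [Fintype ι] {u : ι → F}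
    (hu : Orthonormal 𝕜 u) (c : ι → 𝕜) : ‖∑ i, c i • u i‖ ^ 2 = ∑ i, ‖c i‖ ^ 2 := by
  have h := hu.inner_sum c c Finset.univ
  simp only [inner_self_eq_norm_sq_to_K, RCLike.conj_mul] at h
  exact_mod_cast h

variable [FiniteDimensional 𝕜 E] [FiniteDimensional 𝕜 F]

theorem inner_apply_eigenvectorBasis (T : E →ₗ[𝕜] F) (i j : Fin (finrank 𝕜 E)) :
    ⟪T (T.isSymmetric_adjoint_comp_self.eigenvectorBasis rfl i),
      T (T.isSymmetric_adjoint_comp_self.eigenvectorBasis rfl j)⟫_𝕜 =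
      if i = j then (T.singularValues i : 𝕜) ^ 2 else 0 := by
  have heigen := T.isSymmetric_adjoint_comp_self.apply_eigenvectorBasis rfl j
  rw [← T.sq_singularValues_fin rfl, comp_apply] at heigen
  rw [← adjoint_inner_right, heigen, inner_smul_right, OrthonormalBasis.inner_eq_ite]
  split_ifs with hij <;> simp [hij]

theorem apply_eigenvectorBasis_eq_zero (T : E →ₗ[𝕜] F) {i : Fin (finrank 𝕜 E)}
    (hi : finrank 𝕜 T.range ≤ i) :
    T (T.isSymmetric_adjoint_comp_self.eigenvectorBasis rfl i) = 0 := by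
  rw [← inner_self_eq_zero (𝕜 := 𝕜), inner_apply_eigenvectorBasis, if_pos rfl,
    T.singularValues_eq_zero_iff_le_finrank_range.mpr hi, RCLike.ofReal_zero,
    zero_pow two_ne_zero]

theorem exists_singularValueDecomposition (T : E →ₗ[𝕜] F) :
    ∃ (u : Fin (finrank 𝕜 T.range) → F) (v : Fin (finrank 𝕜 T.range) → E),
      Orthonormal 𝕜 u ∧ Orthonormal 𝕜 v ∧
        ∀ x, T x =
          ∑ i : Fin (finrank 𝕜 T.range), ((T.singularValues i : 𝕜) * ⟪v i, x⟫_𝕜) • u i := by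
  set e := T.isSymmetric_adjoint_comp_self.eigenvectorBasis rfl
  let ι := Fin.castLE T.finrank_range_le
  have hι : Function.Injective ι := Fin.castLE_injective _
  have hpos (i : Fin (finrank 𝕜 T.range)) : (T.singularValues i : 𝕜) ≠ 0 := by
    exact_mod_cast (T.singularValues_pos_iff_lt_finrank_range.mpr i.2).ne'
  have hker : ∀ i ∉ Set.range ι, T (e i) = 0 := fun i hi =>
    apply_eigenvectorBasis_eq_zero T (not_lt.mp fun hlt => hi ⟨⟨i, hlt⟩, rfl⟩)
  refine ⟨fun i => (T.singularValues i : 𝕜)⁻¹ • T (e (ι i)), e ∘ ι, ?_, e.orthonormal.comp ι hι,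
    fun x => ?_⟩
  · rw [orthonormal_iff_ite]
    intro i j
    rw [inner_smul_left, inner_smul_right, inner_apply_eigenvectorBasis]
    simp only [hι.eq_iff]
    split_ifs with hij
    · subst hij
      have := hpos i
      simp only [ι, Fin.val_castLE, map_inv₀, RCLike.conj_ofReal]
      field_simp
    · simp
  · calc T x = ∑ i, ⟪e i, x⟫_𝕜 • T (e i) := by
          conv_lhs => rw [← e.sum_repr' x]
          simp
      _ = ∑ i, ⟪e (ι i), x⟫_𝕜 • T (e (ι i)) :=
          (Fintype.sum_of_injective ι hι _ _ (fun i hi => by rw [hker i hi, smul_zero])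
            fun _ => rfl).symm
      _ = _ := Finset.sum_congr rfl fun i _ => by
          rw [smul_smul, mul_right_comm, mul_inv_cancel₀ (hpos i), one_mul]
          rfl

theorem norm_sum_inner_apply_le (T : E →ₗ[𝕜] F) {ι : Type*} {u : ι → F} {v : ι → E}
    (hu : Orthonormal 𝕜 u) (hv : Orthonormal 𝕜 v) {s : Finset ι} {k : ℕ} (hs : s.card ≤ k) :
    ‖∑ i ∈ s, ⟪u i, T (v i)⟫_𝕜‖ ≤ ∑ i ∈ Finset.range k, T.singularValues i := by
  obtain ⟨f, e, hf, he, hT⟩ := exists_singularValueDecomposition T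
  -- By AM-GM, `w j` bounds the coefficient of the `j`-th singular value of `T`; by Bessel, each
  -- `w j` is at most `1` and they add up to at most `k`.
  let w j := ∑ i ∈ s, (‖⟪e j, v i⟫_𝕜‖ ^ 2 + ‖⟪u i, f j⟫_𝕜‖ ^ 2) / 2
  have column_sum_le j : w j ≤ 1 := by
    have hbessel_v := hv.sum_inner_products_le (e j) (s := s)
    have hbessel_u := hu.sum_inner_products_le (f j) (s := s)
    rw [he.norm_eq_one] at hbessel_v
    rw [hf.norm_eq_one] at hbessel_u
    simp only [w, ← Finset.sum_div, Finset.sum_add_distrib, norm_inner_symm (e j)]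
    linarith
  have row_sum_le : ∑ j, w j ≤ k := by
    rw [Finset.sum_comm]
    refine (Finset.sum_le_card_nsmul s _ 1 fun i _ => ?_).trans (by simpa using hs)
    have hbessel_e := he.sum_inner_products_le (v i) (s := Finset.univ)
    have hbessel_f := hf.sum_inner_products_le (u i) (s := Finset.univ)
    rw [hv.norm_eq_one] at hbessel_e
    rw [hu.norm_eq_one] at hbessel_f
    simp only [← Finset.sum_div, Finset.sum_add_distrib, norm_inner_symm (u i)]
    linarith
  calc ‖∑ i ∈ s, ⟪u i, T (v i)⟫_𝕜‖
      = ‖∑ j : Fin _, ∑ i ∈ s, T.singularValues j * (⟪e j, v i⟫_𝕜 * ⟪u i, f j⟫_𝕜)‖ := by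
        rw [Finset.sum_comm]
        simp only [hT, inner_sum, inner_smul_right, mul_assoc]
    _ ≤ ∑ j : Fin _, ∑ i ∈ s, T.singularValues j * (‖⟪e j, v i⟫_𝕜‖ * ‖⟪u i, f j⟫_𝕜‖) := by
        refine norm_sum_le_of_le _ fun j _ => norm_sum_le_of_le _ fun i _ => ?_
        rw [norm_mul, norm_mul, RCLike.norm_of_nonneg (T.singularValues_nonneg _)]
    _ ≤ ∑ j : Fin _, T.singularValues j * w j := by
        simp only [w, Finset.mul_sum]
        gcongr with j _ i _
        · exact T.singularValues_nonneg _
        · linarith [two_mul_le_add_sq ‖⟪e j, v i⟫_𝕜‖ ‖⟪u i, f j⟫_𝕜‖]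
    _ ≤ ∑ i ∈ Finset.range k, T.singularValues i :=
        sum_mul_le_sum_range T.singularValues_antitone T.singularValues_nonneg
          (fun j => by positivity) column_sum_le row_sum_le

theorem exists_sum_inner_apply_eq (T : E →ₗ[𝕜] F) (k : ℕ) :
    ∃ (u : Fin (finrank 𝕜 T.range) → F) (v : Fin (finrank 𝕜 T.range) → E)
      (s : Finset (Fin (finrank 𝕜 T.range))), Orthonormal 𝕜 u ∧ Orthonormal 𝕜 v ∧ s.card ≤ k ∧
        ∑ i ∈ s, ⟪u i, T (v i)⟫_𝕜 = (∑ i ∈ Finset.range k, T.singularValues i : ℝ) := by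
  obtain ⟨u, v, hu, hv, hT⟩ := exists_singularValueDecomposition T
  have hdiag i : ⟪u i, T (v i)⟫_𝕜 = T.singularValues i := by
    rw [hT, hu.inner_right_fintype, inner_self_eq_norm_sq_to_K, hv.norm_eq_one]
    simp
  let s : Finset (Fin (finrank 𝕜 T.range)) := {i | (i : ℕ) < k}
  have hmap : s.map Fin.valEmbedding ⊆ Finset.range k := fun i hi => by
    obtain ⟨j, hj, rfl⟩ := Finset.mem_map.mp hi
    exact Finset.mem_range.mpr (Finset.mem_filter.mp hj).2
  refine ⟨u, v, s, hu, hv, ?_, ?_⟩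
  · simpa using Finset.card_le_card hmap
  · rw [Finset.sum_congr rfl fun i _ => hdiag i, ← RCLike.ofReal_sum,
      ← Finset.sum_subset hmap, Finset.sum_map]
    · rfl
    · intro i hi hni
      refine T.singularValues_eq_zero_iff_le_finrank_range.mpr (not_lt.mp fun hlt => hni ?_)
      exact Finset.mem_map.mpr ⟨⟨i, hlt⟩, by simpa [s] using hi, rfl⟩

/-- The Ky Fan `k`-norm, the sum of the `k` largest singular values. -/
noncomputable def kyFanSeminorm (k : ℕ) : Seminorm 𝕜 (E →ₗ[𝕜] F) :=
  Seminorm.ofSMulLE (fun T => ∑ i ∈ Finset.range k, T.singularValues i) (by simp)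
    (fun S T => by
      obtain ⟨u, v, s, hu, hv, hs, heq⟩ := exists_sum_inner_apply_eq (S + T) k
      rw [← RCLike.norm_of_nonneg (K := 𝕜) (Finset.sum_nonneg fun i _ =>
        (S + T).singularValues_nonneg i), ← heq]
      simp only [LinearMap.add_apply, inner_add_right, Finset.sum_add_distrib]
      exact (norm_add_le _ _).trans
        (add_le_add (norm_sum_inner_apply_le S hu hv hs) (norm_sum_inner_apply_le T hu hv hs)))
    (fun c T => by
      obtain ⟨u, v, s, hu, hv, hs, heq⟩ := exists_sum_inner_apply_eq (c • T) k
      rw [← RCLike.norm_of_nonneg (K := 𝕜) (Finset.sum_nonneg fun i _ =>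
        (c • T).singularValues_nonneg i), ← heq]
      simp only [LinearMap.smul_apply, inner_smul_right, ← Finset.mul_sum, norm_mul]
      gcongr
      exact norm_sum_inner_apply_le T hu hv hs)

theorem norm_inner_apply_le_singularValues_zero (T : E →ₗ[𝕜] F) {x : E} {y : F}
    (hx : ‖x‖ = 1) (hy : ‖y‖ = 1) :
    ‖⟪y, T x⟫_𝕜‖ ≤ T.singularValues 0 := by
  simpa using norm_sum_inner_apply_le T (u := fun _ : Unit => y) (v := fun _ => x) (k := 1)
    (s := Finset.univ) (by simp [hy]) (by simp [hx]) le_rfl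

theorem sum_sq_norm_apply_orthonormalBasis (T : E →ₗ[𝕜] F) {ι : Type*} [Fintype ι]
    (b : OrthonormalBasis ι 𝕜 E) {k : ℕ} (hk : finrank 𝕜 T.range ≤ k) :
    ∑ j, ‖T (b j)‖ ^ 2 = ∑ i ∈ Finset.range k, T.singularValues i ^ 2 := by
  obtain ⟨u, v, hu, hv, hT⟩ := exists_singularValueDecomposition T
  calc ∑ j, ‖T (b j)‖ ^ 2 = ∑ j, ∑ i : Fin _, ‖(T.singularValues i : 𝕜) * ⟪v i, b j⟫_𝕜‖ ^ 2 :=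
        Finset.sum_congr rfl fun j _ => by rw [hT, norm_sq_sum_smul_of_orthonormal hu]
    _ = ∑ i : Fin _, T.singularValues i ^ 2 * ∑ j, ‖⟪v i, b j⟫_𝕜‖ ^ 2 := by
        rw [Finset.sum_comm]
        simp only [norm_mul, mul_pow, RCLike.norm_ofReal, sq_abs, Finset.mul_sum]
    _ = ∑ i : Fin (finrank 𝕜 T.range), T.singularValues i ^ 2 := by
        simp only [b.sum_sq_norm_inner_left, hv.norm_eq_one, one_pow, mul_one]
    _ = ∑ i ∈ Finset.range (finrank 𝕜 T.range), T.singularValues i ^ 2 :=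
        Fin.sum_univ_eq_sum_range (fun i => T.singularValues i ^ 2) _
    _ = ∑ i ∈ Finset.range k, T.singularValues i ^ 2 := by
        refine Finset.sum_subset (Finset.range_mono hk) fun i _ hi => ?_
        rw [T.singularValues_eq_zero_iff_le_finrank_range.mpr (not_lt.mp (by simpa using hi)),
          zero_pow two_ne_zero]

end LinearMap

section Matrix

open Matrix Module

variable {m n : ℕ} {A B : Matrix (Fin m) (Fin n) ℂ} {p : ℝ}

/-- The singular values of a complex matrix as an infinite sequence: `sigma A` followed by zeros.
Working with the whole sequence avoids splitting off the case `min m n = 0`. -/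
noncomputable abbrev singularValueSeq (A : Matrix (Fin m) (Fin n) ℂ) : ℕ →₀ ℝ :=
  (toEuclideanLin A).singularValues

theorem finrank_range_toEuclideanLin_le (A : Matrix (Fin m) (Fin n) ℂ) :
    finrank ℂ (toEuclideanLin A).range ≤ min m n :=
  le_min (by simpa using Submodule.finrank_le (toEuclideanLin A).range)
    (by simpa using (toEuclideanLin A).finrank_range_le)

theorem singularValueSeq_eq_zero (A : Matrix (Fin m) (Fin n) ℂ) {i : ℕ} (hi : min m n ≤ i) :
    singularValueSeq A i = 0 :=
  (toEuclideanLin A).singularValues_eq_zero_iff_le_finrank_range.mpr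
    ((finrank_range_toEuclideanLin_le A).trans hi)

theorem singularValueSeq_nonneg (A : Matrix (Fin m) (Fin n) ℂ) (i : ℕ) :
    0 ≤ singularValueSeq A i :=
  LinearMap.singularValues_nonneg _ i

theorem sum_sigma_rpow (A : Matrix (Fin m) (Fin n) ℂ) (hp : p ≠ 0) {k : ℕ} (hk : min m n ≤ k) :
    ∑ i, sigma A i ^ p = ∑ i ∈ Finset.range k, singularValueSeq A i ^ p := by
  rw [← Finset.sum_subset (Finset.range_mono hk), ← Fin.sum_univ_eq_sum_range]
  · rfl
  · intro i _ hi
    rw [singularValueSeq_eq_zero A (not_lt.mp (mt Finset.mem_range.mpr hi)), Real.zero_rpow hp]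

theorem norm_entry_le_singularValueSeq_zero (A : Matrix (Fin m) (Fin n) ℂ) (i : Fin m)
    (j : Fin n) : ‖A i j‖ ≤ singularValueSeq A 0 := by
  simpa [EuclideanSpace.inner_single_left, toLpLin_apply] using
    norm_inner_apply_le_singularValues_zero (toEuclideanLin A) (x := EuclideanSpace.single j 1)
      (y := EuclideanSpace.single i 1) (by simp) (by simp)

theorem sum_sq_sigma (A : Matrix (Fin m) (Fin n) ℂ) :
    ∑ i, sigma A i ^ 2 = ∑ j, ∑ i, ‖A i j‖ ^ 2 := by
  calc ∑ i, sigma A i ^ 2 = ∑ i ∈ Finset.range (min m n), singularValueSeq A i ^ 2 :=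
        Fin.sum_univ_eq_sum_range (fun i => singularValueSeq A i ^ 2) _
    _ = ∑ j, ‖toEuclideanLin A (EuclideanSpace.basisFun (Fin n) ℂ j)‖ ^ 2 :=
        (sum_sq_norm_apply_orthonormalBasis _ _ (finrank_range_toEuclideanLin_le A)).symm
    _ = ∑ j, ∑ i, ‖A i j‖ ^ 2 := by
        simp [EuclideanSpace.norm_sq_eq, toLpLin_apply]

theorem sigma_smul_add_smul_ne (hAB : A ≠ B) (h : sigma A = sigma B) {a b : ℝ} (ha : 0 < a)
    (hb : 0 < b) (hab : a + b = 1) : sigma (a • A + b • B) ≠ sigma A := by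
  let vec (X : Matrix (Fin m) (Fin n) ℂ) : EuclideanSpace ℂ (Fin n × Fin m) :=
    WithLp.toLp 2 fun ij => X ij.2 ij.1
  have norm_sq_vec X : ‖vec X‖ ^ 2 = ∑ i, sigma X i ^ 2 := by
    rw [EuclideanSpace.norm_sq_eq, Fintype.sum_prod_type, sum_sq_sigma]
  have norm_vec_eq {X Y} (hXY : sigma X = sigma Y) : ‖vec X‖ = ‖vec Y‖ := by
    rw [← sq_eq_sq₀ (norm_nonneg _) (norm_nonneg _), norm_sq_vec, norm_sq_vec, hXY]
  have vec_ne : vec A ≠ vec B := fun heq =>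
    hAB (Matrix.ext fun i j => congrFun (congrArg WithLp.ofLp heq) (j, i))
  intro hcombo
  have vec_combo : vec (a • A + b • B) = a • vec A + b • vec B := rfl
  have hlt : ‖a • vec A + b • vec B‖ < ‖vec A‖ :=
    norm_combo_lt_of_ne le_rfl (norm_vec_eq h).ge vec_ne ha hb hab
  exact hlt.ne (vec_combo ▸ norm_vec_eq hcombo)

theorem convexOn_sum_range_singularValueSeq (k : ℕ) :
    ConvexOn ℝ Set.univ fun A : Matrix (Fin m) (Fin n) ℂ =>
      ∑ i ∈ Finset.range k, singularValueSeq A i :=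
  (kyFanSeminorm (𝕜 := ℂ) (E := EuclideanSpace ℂ (Fin n)) (F := EuclideanSpace ℂ (Fin m))
    k).convexOn.comp_linearMap (toEuclideanLin.toLinearMap.restrictScalars ℝ)

theorem continuous_singularValueSeq (i : ℕ) :
    Continuous fun A : Matrix (Fin m) (Fin n) ℂ => singularValueSeq A i := by
  let _ : NormedAddCommGroup (Matrix (Fin m) (Fin n) ℂ) := Matrix.normedAddCommGroup
  let _ : NormedSpace ℝ (Matrix (Fin m) (Fin n) ℂ) := Matrix.normedSpace
  have continuous_sum_range k : Continuous fun A : Matrix (Fin m) (Fin n) ℂ =>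
      ∑ i ∈ Finset.range k, singularValueSeq A i :=
    (convexOn_sum_range_singularValueSeq k).locallyLipschitz.continuous
  exact ((continuous_sum_range (i + 1)).sub (continuous_sum_range i)).congr
    fun A => Finset.sum_range_succ_sub_sum _

theorem isCompact_setOf_singularValueSeq_sub_le (A : Matrix (Fin m) (Fin n) ℂ) (C : ℝ) :
    IsCompact {X | singularValueSeq (A - X) 0 ≤ C} := by
  suffices h : IsCompact {B : Matrix (Fin m) (Fin n) ℂ | singularValueSeq B 0 ≤ C} from
    (Homeomorph.subLeft A).isCompact_preimage.mpr h
  refine (isCompact_univ_pi fun _ => isCompact_univ_pi fun _ =>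
    isCompact_closedBall (0 : ℂ) C).of_isClosed_subset
      (isClosed_le (continuous_singularValueSeq 0) continuous_const) ?_
  exact fun B hB i _ j _ =>
    mem_closedBall_zero_iff.mpr ((norm_entry_le_singularValueSeq_zero B i j).trans hB)

theorem strictConvexOn_sum_sigma_rpow (hp : 1 < p) :
    StrictConvexOn ℝ Set.univ fun A : Matrix (Fin m) (Fin n) ℂ => ∑ i, sigma A i ^ p := by
  refine ⟨convex_univ, fun A _ B _ hAB a b ha hb hab => ?_⟩
  have combo_rpow_le (i : Fin (min m n)) :
      (a * sigma A i + b * sigma B i) ^ p ≤ a * sigma A i ^ p + b * sigma B i ^ p :=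
    (strictConvexOn_rpow hp).convexOn.2 (singularValueSeq_nonneg A i)
      (singularValueSeq_nonneg B i) ha.le hb.le hab
  simp only [smul_eq_mul, Finset.mul_sum, ← Finset.sum_add_distrib]
  by_contra! hle
  have sigma_combo_eq (i : Fin (min m n)) :
      sigma (a • A + b • B) i = a * sigma A i + b * sigma B i := by
    refine eq_of_sum_rpow_le_of_sum_range_le hp (a := fun i =>
      a * singularValueSeq A i + b * singularValueSeq B i) (fun i => ?_)
      (singularValueSeq_nonneg _) (LinearMap.singularValues_antitone _) (fun k _ => ?_) ?_ i i.2
    · have := singularValueSeq_nonneg A i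
      have := singularValueSeq_nonneg B i
      positivity
    · rw [Finset.sum_add_distrib, ← Finset.mul_sum, ← Finset.mul_sum]
      exact (convexOn_sum_range_singularValueSeq k).2 trivial trivial ha.le hb.le hab
    · rw [← sum_sigma_rpow _ (by linarith) le_rfl, ← Fin.sum_univ_eq_sum_range
        (fun i => (a * singularValueSeq A i + b * singularValueSeq B i) ^ p)]
      exact (Finset.sum_le_sum fun i _ => combo_rpow_le i).trans hle
  have hσ : sigma A = sigma B := by
    by_contra! hne
    obtain ⟨i, hi⟩ := Function.ne_iff.mp hne
    simp only [sigma_combo_eq] at hle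
    refine hle.not_gt (Finset.sum_lt_sum (fun j _ => combo_rpow_le j) ⟨i, Finset.mem_univ i, ?_⟩)
    exact (strictConvexOn_rpow hp).2 (singularValueSeq_nonneg A i) (singularValueSeq_nonneg B i)
      hi ha hb hab
  refine sigma_smul_add_smul_ne hAB hσ ha hb hab (funext fun i => ?_)
  rw [sigma_combo_eq, ← hσ, ← add_mul, hab, one_mul]

theorem toLex_sigma_smul_add_smul_lt (hAB : A ≠ B) (h : sigma A = sigma B) {a b : ℝ} (ha : 0 < a)
    (hb : 0 < b) (hab : a + b = 1) : toLex (sigma (a • A + b • B)) < toLex (sigma A) := by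
  refine lt_of_not_ge fun hle => sigma_smul_add_smul_ne hAB h ha hb hab
    (eq_of_toLex_le_of_sum_range_le (fun k hk => ?_) hle).symm
  have hsum : ∑ i ∈ Finset.range k, singularValueSeq B i =
      ∑ i ∈ Finset.range k, singularValueSeq A i :=
    Finset.sum_congr rfl fun i hi =>
      congrFun h.symm ⟨i, (Finset.mem_range.mp hi).trans_le hk⟩
  have hconvex := (convexOn_sum_range_singularValueSeq k).2 (Set.mem_univ A) (Set.mem_univ B)
    ha.le hb.le hab
  simpa only [hsum, ← add_smul, hab, one_smul] using hconvex

theorem singularValueSeq_zero_le_of_toLex_le (h : toLex (sigma A) ≤ toLex (sigma B)) :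
    singularValueSeq A 0 ≤ singularValueSeq B 0 := by
  rcases Nat.eq_zero_or_pos (min m n) with h₀ | h₀
  · rw [singularValueSeq_eq_zero A h₀.le]
    exact singularValueSeq_nonneg B 0
  · exact Pi.apply_le_of_toLex (i := ⟨0, h₀⟩) h fun j hj => absurd hj (Nat.not_lt_zero j)

theorem cpNorm_le_cpNorm_iff (hp : 0 < p) :
    cpNorm p A ≤ cpNorm p B ↔ ∑ i, sigma A i ^ p ≤ ∑ i, sigma B i ^ p :=
  Real.rpow_le_rpow_iff
    (Finset.sum_nonneg fun i _ => Real.rpow_nonneg (singularValueSeq_nonneg A i) p)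
    (Finset.sum_nonneg fun i _ => Real.rpow_nonneg (singularValueSeq_nonneg B i) p)
    (one_div_pos.mpr hp)

theorem continuous_cpNorm (hp : 0 < p) :
    Continuous (cpNorm p : Matrix (Fin m) (Fin n) ℂ → ℝ) :=
  (continuous_finsetSum Finset.univ fun (i : Fin (min m n)) _ =>
    (continuous_singularValueSeq i).rpow_const fun _ => Or.inr hp.le).rpow_const
      fun _ => Or.inr (one_div_pos.mpr hp).le

theorem singularValueSeq_zero_le_cpNorm (hp : 0 < p) (A : Matrix (Fin m) (Fin n) ℂ) :
    singularValueSeq A 0 ≤ cpNorm p A := by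
  have hnonneg i := Real.rpow_nonneg (singularValueSeq_nonneg A i) p
  calc singularValueSeq A 0 = (singularValueSeq A 0 ^ p) ^ (1 / p) := by
        rw [one_div, Real.rpow_rpow_inv (singularValueSeq_nonneg A 0) hp.ne']
    _ ≤ cpNorm p A := by
        rw [cpNorm, sum_sigma_rpow A hp.ne' (min m n).le_succ]
        gcongr
        · exact hnonneg 0
        · exact Finset.single_le_sum (fun i _ => hnonneg i) (Finset.mem_range.mpr (Nat.succ_pos _))

theorem cpNorm_le_rpow_mul_singularValueSeq_zero (hp : 0 < p) (A : Matrix (Fin m) (Fin n) ℂ)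
    {k : ℕ} (hk : min m n ≤ k) :
    cpNorm p A ≤ (k : ℝ) ^ (1 / p) * singularValueSeq A 0 := by
  have hnonneg := singularValueSeq_nonneg A
  calc cpNorm p A ≤ (k * singularValueSeq A 0 ^ p) ^ (1 / p) := by
        rw [cpNorm, sum_sigma_rpow A hp.ne' hk]
        gcongr
        · exact Finset.sum_nonneg fun i _ => Real.rpow_nonneg (hnonneg i) p
        · simpa using Finset.sum_le_card_nsmul (Finset.range k) _ _ fun i _ =>
            Real.rpow_le_rpow (hnonneg i) (LinearMap.singularValues_antitone _ i.zero_le) hp.le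
    _ = (k : ℝ) ^ (1 / p) * singularValueSeq A 0 := by
        rw [Real.mul_rpow k.cast_nonneg (Real.rpow_nonneg (hnonneg 0) p), one_div,
          Real.rpow_rpow_inv (hnonneg 0) hp.ne']

theorem singularValueSeq_one_le_of_cpNorm_le (hmn : min m n ≤ 2) (hp : 0 < p)
    (h : cpNorm p A ≤ cpNorm p B) (h₀ : singularValueSeq B 0 ≤ singularValueSeq A 0) :
    singularValueSeq A 1 ≤ singularValueSeq B 1 := by
  rw [cpNorm_le_cpNorm_iff hp, sum_sigma_rpow A hp.ne' hmn, sum_sigma_rpow B hp.ne' hmn,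
    Finset.sum_range_succ, Finset.sum_range_one, Finset.sum_range_succ, Finset.sum_range_one] at h
  rw [← Real.rpow_le_rpow_iff (singularValueSeq_nonneg A 1) (singularValueSeq_nonneg B 1) hp]
  linarith [Real.rpow_le_rpow (singularValueSeq_nonneg B 0) h₀ hp.le]

end Matrix

section Approximation

variable {m n : ℕ} {K : Set (Matrix (Fin m) (Fin n) ℂ)} {A Y Z : Matrix (Fin m) (Fin n) ℂ} {p : ℝ}

theorem smul_sub_add_smul_sub {V : Type*} [AddCommGroup V] [Module ℝ V] (A Y Z : V) {a b : ℝ}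
    (hab : a + b = 1) : a • (A - Y) + b • (A - Z) = A - (a • Y + b • Z) := by
  rw [smul_sub, smul_sub, sub_add_sub_comm, ← add_smul, hab, one_smul]

theorem IsCpApprox.unique (hconv : Convex ℝ K) (hp : 1 < p) (hY : IsCpApprox K A p Y)
    (hZ : IsCpApprox K A p Z) : Y = Z := by
  have hstrict : StrictConvexOn ℝ K fun X => ∑ i, sigma (A - X) i ^ p := by
    refine ⟨hconv, fun X _ X' _ hne a b ha hb hab => ?_⟩
    simpa only [smul_sub_add_smul_sub A X X' hab] using (strictConvexOn_sum_sigma_rpow hp).2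
      (Set.mem_univ (A - X)) (Set.mem_univ (A - X')) (sub_right_injective.ne hne) ha hb hab
  have isMinOn {W} (hW : IsCpApprox K A p W) :
      IsMinOn (fun X => ∑ i, sigma (A - X) i ^ p) K W := fun X hX =>
    (cpNorm_le_cpNorm_iff (by linarith)).mp (hW.2 X hX)
  exact hstrict.eq_of_isMinOn (isMinOn hY) (isMinOn hZ) hY.1 hZ.1

theorem exists_isCpApprox (hK : IsClosed K) (hne : K.Nonempty) (hp : 0 < p)
    (A : Matrix (Fin m) (Fin n) ℂ) : ∃ Y, IsCpApprox K A p Y := by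
  obtain ⟨X₀, hX₀⟩ := hne
  refine ContinuousOn.exists_isMinOn' (f := fun X => cpNorm p (A - X))
    ((continuous_cpNorm hp).comp (continuous_sub_left A)).continuousOn hK hX₀ ?_
  filter_upwards [mem_inf_of_left
    (isCompact_setOf_singularValueSeq_sub_le A (cpNorm p (A - X₀))).compl_mem_cocompact] with X hX
  exact (le_of_not_ge fun hle => hX hle).trans (singularValueSeq_zero_le_cpNorm hp _)

theorem existsUnique_isCpApprox (hK : IsClosed K) (hconv : Convex ℝ K) (hne : K.Nonempty)
    (hp : 1 < p) (A : Matrix (Fin m) (Fin n) ℂ) : ∃! Y, IsCpApprox K A p Y :=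
  existsUnique_of_exists_of_unique (exists_isCpApprox hK hne (by linarith) A)
    fun _ _ => IsCpApprox.unique hconv hp

theorem IsStrictSpectralApprox.unique (hconv : Convex ℝ K) (hY : IsStrictSpectralApprox K A Y)
    (hZ : IsStrictSpectralApprox K A Z) : Y = Z := by
  by_contra hne
  have hσ : sigma (A - Y) = sigma (A - Z) :=
    toLex_inj.mp ((hY.2 Z hZ.1).antisymm (hZ.2 Y hY.1))
  have hlt := toLex_sigma_smul_add_smul_lt (sub_right_injective.ne hne) hσ one_half_pos one_half_pos
    (add_halves 1)
  rw [smul_sub_add_smul_sub A Y Z (add_halves 1)] at hlt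
  exact hlt.not_ge
    (hY.2 _ (hconv hY.1 hZ.1 one_half_pos.le one_half_pos.le (add_halves 1)))

theorem exists_isStrictSpectralApprox (hK : IsClosed K) (hne : K.Nonempty)
    (A : Matrix (Fin m) (Fin n) ℂ) : ∃ Y, IsStrictSpectralApprox K A Y := by
  obtain ⟨X₀, hX₀⟩ := hne
  obtain ⟨Y, ⟨hYX₀, hYK⟩, hY⟩ := exists_forall_toLex_le_of_isCompact
    (f := fun X => sigma (A - X))
    (fun i => (continuous_singularValueSeq i).comp (continuous_sub_left A))
    ((isCompact_setOf_singularValueSeq_sub_le A (singularValueSeq (A - X₀) 0)).inter_right hK)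
    ⟨X₀, le_refl (singularValueSeq (A - X₀) 0), hX₀⟩
  refine ⟨Y, hYK, fun X hX => ?_⟩
  rcases le_total (toLex (sigma (A - Y))) (toLex (sigma (A - X))) with hle | hge
  · exact hle
  · exact hY X ⟨(singularValueSeq_zero_le_of_toLex_le hge).trans hYX₀, hX⟩

theorem existsUnique_isStrictSpectralApprox (hK : IsClosed K) (hconv : Convex ℝ K)
    (hne : K.Nonempty) (A : Matrix (Fin m) (Fin n) ℂ) : ∃! Y, IsStrictSpectralApprox K A Y :=
  existsUnique_of_exists_of_unique (exists_isStrictSpectralApprox hK hne A)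
    fun _ _ => IsStrictSpectralApprox.unique hconv

theorem tendsto_singularValueSeq_zero_of_isCpApprox {Y : ℝ → Matrix (Fin m) (Fin n) ℂ}
    (hY : ∀ᶠ p in atTop, IsCpApprox K A p (Y p)) (hZ : IsStrictSpectralApprox K A Z) :
    Tendsto (fun p => singularValueSeq (A - Y p) 0) atTop (𝓝 (singularValueSeq (A - Z) 0)) := by
  -- `min m n + 1` rather than `min m n` keeps the base of the power nonzero.
  have upper_tendsto :
      Tendsto (fun p : ℝ => ((min m n + 1 : ℕ) : ℝ) ^ (1 / p) * singularValueSeq (A - Z) 0) atTop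
        (𝓝 (singularValueSeq (A - Z) 0)) := by
    have hpow : Tendsto (fun p : ℝ => ((min m n + 1 : ℕ) : ℝ) ^ (1 / p)) atTop (𝓝 1) := by
      have hinv : Tendsto (fun p : ℝ => 1 / p) atTop (𝓝 0) := by
        simpa only [one_div] using tendsto_inv_atTop_zero (𝕜 := ℝ)
      simpa only [Real.rpow_zero] using
        tendsto_const_nhds.rpow hinv (Or.inl (Nat.cast_ne_zero.mpr (min m n).succ_ne_zero))
    simpa only [one_mul] using hpow.mul_const (singularValueSeq (A - Z) 0)
  refine tendsto_of_tendsto_of_tendsto_of_le_of_le' tendsto_const_nhds upper_tendsto ?_ ?_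
  · filter_upwards [hY] with p hYp
    exact singularValueSeq_zero_le_of_toLex_le (hZ.2 _ hYp.1)
  · filter_upwards [hY, eventually_gt_atTop 0] with p hYp hp
    calc singularValueSeq (A - Y p) 0 ≤ cpNorm p (A - Y p) := singularValueSeq_zero_le_cpNorm hp _
      _ ≤ cpNorm p (A - Z) := hYp.2 Z hZ.1
      _ ≤ _ := cpNorm_le_rpow_mul_singularValueSeq_zero hp _ (min m n).le_succ

theorem tendsto_of_isCpApprox (hmn : min m n ≤ 2) (hK : IsClosed K) (hconv : Convex ℝ K)
    {Y : ℝ → Matrix (Fin m) (Fin n) ℂ} (hY : ∀ᶠ p in atTop, IsCpApprox K A p (Y p))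
    (hZ : IsStrictSpectralApprox K A Z) : Tendsto Y atTop (𝓝 Z) := by
  have continuous_sigma_sub i : Continuous fun X => singularValueSeq (A - X) i :=
    (continuous_singularValueSeq i).comp (continuous_sub_left A)
  have hlim := tendsto_singularValueSeq_zero_of_isCpApprox hY hZ
  have eventually_second_le : ∀ᶠ p in atTop,
      singularValueSeq (A - Y p) 1 ≤ singularValueSeq (A - Z) 1 := by
    filter_upwards [hY, eventually_gt_atTop 0] with p hYp hp
    exact singularValueSeq_one_le_of_cpNorm_le hmn hp (hYp.2 Z hZ.1)
      (singularValueSeq_zero_le_of_toLex_le (hZ.2 _ hYp.1))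
  refine (isCompact_setOf_singularValueSeq_sub_le A
    (singularValueSeq (A - Z) 0 + 1)).tendsto_nhds_of_unique_mapClusterPt
      ((hlim.eventually_lt_const (lt_add_one _)).mono fun _ => le_of_lt) fun W _ hW => ?_
  have hWK : W ∈ K := hK.mem_of_mapClusterPt hW (hY.mono fun _ h => h.1)
  have first_eq : singularValueSeq (A - W) 0 = singularValueSeq (A - Z) 0 :=
    eq_of_nhds_neBot ((hW.tendsto_comp (continuous_sigma_sub 0).continuousAt).neBot.mono
      (inf_le_inf_left _ hlim))
  have second_le : singularValueSeq (A - W) 1 ≤ singularValueSeq (A - Z) 1 :=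
    (isClosed_le (continuous_sigma_sub 1) continuous_const).mem_of_mapClusterPt hW
      eventually_second_le
  have sigma_le : sigma (A - W) ≤ sigma (A - Z) := fun ⟨i, hi⟩ => by
    obtain rfl | rfl : i = 0 ∨ i = 1 := by omega
    exacts [first_eq.le, second_le]
  exact IsStrictSpectralApprox.unique hconv
    ⟨hWK, fun X hX => (Pi.toLex_monotone sigma_le).trans (hZ.2 X hX)⟩ hZ

end Approximation

end SpectralApprox

theorem mainTheorem4_general {m n : ℕ} {K : Set (Matrix (Fin m) (Fin n) ℂ)} (hK : IsClosed K)
    (hconv : Convex ℝ K) (hne : K.Nonempty) (A : Matrix (Fin m) (Fin n) ℂ) :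
    (∀ p : ℝ, 1 < p → ∃! Y, SpectralApprox.IsCpApprox K A p Y) ∧
    (∃! Y, SpectralApprox.IsStrictSpectralApprox K A Y) ∧
    (min m n ≤ 2 → ∀ (Y : ℝ → Matrix (Fin m) (Fin n) ℂ) (Yst : Matrix (Fin m) (Fin n) ℂ),
      (∀ p : ℝ, 1 < p → SpectralApprox.IsCpApprox K A p (Y p)) →
      SpectralApprox.IsStrictSpectralApprox K A Yst → Tendsto Y atTop (𝓝 Yst)) :=
  ⟨fun _ hp => SpectralApprox.existsUnique_isCpApprox hK hconv hne hp A,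
    SpectralApprox.existsUnique_isStrictSpectralApprox hK hconv hne A,
    fun hmn _ _ hY hYst => SpectralApprox.tendsto_of_isCpApprox hmn hK hconv
      ((eventually_gt_atTop 1).mono hY) hYst⟩

/-- For complex `m × n` matrices with `m = 2` or `n = 2`, and any linear subspace `M` (real linear;
every complex subspace is one), the `c_p`-approximations `Y_p` of `A` exist and are unique for
`1 < p < ∞`, the strict spectral approximation `Y^(st)` exists and is unique, and
`Y_p → Y^(st)` as `p → ∞`. -/
theorem mainTheorem4 (m n : ℕ) (hmn : m = 2 ∨ n = 2)
    (M : Submodule ℝ (Matrix (Fin m) (Fin n) ℂ)) (A : Matrix (Fin m) (Fin n) ℂ) :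
    (∀ p : ℝ, 1 < p →
      ∃! Y : Matrix (Fin m) (Fin n) ℂ, SpectralApprox.IsCpApprox (M : Set _) A p Y) ∧
    (∃! Y : Matrix (Fin m) (Fin n) ℂ, SpectralApprox.IsStrictSpectralApprox (M : Set _) A Y) ∧
    (∀ (Y : ℝ → Matrix (Fin m) (Fin n) ℂ) (Yst : Matrix (Fin m) (Fin n) ℂ),
      (∀ p : ℝ, 1 < p → SpectralApprox.IsCpApprox (M : Set _) A p (Y p)) →
      SpectralApprox.IsStrictSpectralApprox (M : Set _) A Yst →
      Tendsto Y atTop (𝓝 Yst)) := by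
  obtain ⟨hcp, hst, hlim⟩ := mainTheorem4_general (Submodule.closed_of_finiteDimensional M)
    M.convex ⟨0, M.zero_mem⟩ A
  exact ⟨hcp, hst, hlim (by omega)⟩
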